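/- Let $N\ge 2$ and $0<\alpha<1/2$. For $f:\mathbb{Z}^N\to\mathbb{C}$ put $|\mathbf n|=|n_1|+\cdots+|n_N|$ and $$[f]_{C^{0,\alpha}}=\sup_{\mathbf n\ne\mathbf m}\frac{|f(\mathbf n)-f(\mathbf m)|}{|\mathbf n-\mathbf m|^{\alpha}},\qquad f\in C^{0,\alpha}(\mathbb{Z}^N)\iff [f]_{C^{0,\alpha}}<\infty .$$ Let $\delta_i^+f(\mathbf n)=f(\mathbf n+\mathbf e_i)-f(\mathbf n)$, let $G_{t,N}(\mathbf n)=\prod_{j=1}^N e^{-2t}I_{n_j}(2t)$, where $I_a$ is the modified Bessel function of the first kind, let $W_tf(\mathbf n)=\sum_{\mathbf k\in\mathbb{Z}^N}G_{t,N}(\mathbf n-\mathbf k)f(\mathbf k)$ be the heat semigroup of the discrete Laplacian $\Delta_N$, and put $$(-\Delta_N)^{-1/2}f(\mathbf n)=\frac1{\sqrt\pi}\int_0^\infty W_tf(\mathbf n)\,t^{-1/2}\,dt,\qquad \mathcal R_i(\mathbf n)=\frac1{\sqrt\pi}\int_0^\infty \delta_i^+G_{t,N}(\mathbf n)\,t^{-1/2}\,dt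 .$$ **Theorem (Riesz transforms on Hölder classes).** There is a constant $C=C(N,\alpha)$ such that for all $1\le i\le N$ and all $f\in C^{0,\alpha}(\mathbb{Z}^N)$ the Riesz transform $R_i=\delta_i^+(-\Delta_N)^{-1/2}$ satisfies $$[R_if]_{C^{0,\alpha}}\le C\,[f]_{C^{0,\alpha}} .$$ Here the inequality holds in each of the following senses. 1. For $R_if=\delta_i^+(-\Delta_N)^{-1/2}f$, if the integral defining $(-\Delta_N)^{-1/2}f(\mathbf n)$ converges absolutely for every $\mathbf n$. 2. For $R_if=\mathcal R_i*f$, that is $R_if(\mathbf n)=\sum_{\mathbf k}\mathcal R_i(\mathbf n-\mathbf k)f(\mathbf k)$, if this series converges absolutely for every $\mathbf n$. 3. For every $f\in C^{0,\alpha}(\mathbb{Z}^N)$, with $R_if$ understood modulo additive constants (which $[\,\cdot\,]_{C^{0,\alpha}}$ does not see): for all $\mathbf n,\mathbf m$ the integral $\int_0^\infty\big(\delta_i^+W_tf(\mathbf n)-\delta_i^+W_tf(\mathbf m)\big)t^{-1/2}\,dt$, which represents $\sqrt\pi\,(R_if(\mathbf n)-R_if(\mathbf m))$, converges absolutely, and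 the function $\mathbf n\mapsto\frac1{\sqrt\pi}\int_0^\infty\big(\delta_i^+W_tf(\mathbf n)-\delta_i^+W_tf(\mathbf 0)\big)t^{-1/2}\,dt$ satisfies the inequality. -/

import Mathlib

open MeasureTheory Set
open scoped ENNReal NNReal

namespace DiscreteRiesz

noncomputable section

/-- The modified Bessel function of the first kind of order `a`,
`I_a(x) = ∑_{k ≥ 0} (x/2)^(2k+a) / (k! Γ(a+k+1))` for `x > 0`. The terms with
`a + k + 1 ∈ {0, -1, -2, …}` vanish, as they should: there `Real.Gamma` takes the value `0`, and
division by `0` gives `0`. -/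
def besselI (a x : ℝ) : ℝ :=
  ∑' k : ℕ, (x / 2) ^ (2 * (k : ℝ) + a) / ((k.factorial : ℝ) * Real.Gamma (a + k + 1))

/-- The discrete heat kernel `G_{t,N}(n) = ∏_j e^{-2t} I_{n_j}(2t)` on `ℤ^N`, for `t > 0`. -/
def heatKernel {N : ℕ} (t : ℝ) (n : Fin N → ℤ) : ℝ :=
  ∏ j, Real.exp (-2 * t) * besselI (n j : ℝ) (2 * t)

/-- The heat semigroup `W_t f(n) = ∑_{k ∈ ℤ^N} G_{t,N}(n - k) f(k)`, for `t > 0`. -/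
def heatSemigroup {N : ℕ} (t : ℝ) (f : (Fin N → ℤ) → ℂ) (n : Fin N → ℤ) : ℂ :=
  ∑' k : Fin N → ℤ, (heatKernel t (n - k) : ℂ) * f k

/-- The forward difference `δ_i^+ f(n) = f(n + e_i) - f(n)`. -/
def fwd {N : ℕ} {E : Type*} [AddCommGroup E] (i : Fin N) (f : (Fin N → ℤ) → E)
    (n : Fin N → ℤ) : E :=
  f (n + Pi.single i 1) - f n

/-- The integral that defines `(-Δ_N)^{-σ} f(n)` converges (absolutely) for every `n`. -/
def FracIntegralConverges {N : ℕ} (σ : ℝ) (f : (Fin N → ℤ) → ℂ) : Prop :=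
  ∀ n, IntegrableOn (fun t : ℝ => heatSemigroup t f n * ((t ^ (σ - 1) : ℝ) : ℂ)) (Ioi 0)

/-- The fractional integral
`(-Δ_N)^{-σ} f(n) = Γ(σ)⁻¹ ∫_0^∞ W_t f(n) t^{σ-1} dt`. -/
def fracIntegral {N : ℕ} (σ : ℝ) (f : (Fin N → ℤ) → ℂ) (n : Fin N → ℤ) : ℂ :=
  ((1 / Real.Gamma σ : ℝ) : ℂ) *
    ∫ t in Ioi (0 : ℝ), heatSemigroup t f n * ((t ^ (σ - 1) : ℝ) : ℂ)

/-- The Riesz transform `R_i f = δ_i^+ (-Δ_N)^{-1/2} f`. -/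
def rieszTransform {N : ℕ} (i : Fin N) (f : (Fin N → ℤ) → ℂ) : (Fin N → ℤ) → ℂ :=
  fwd i (fracIntegral (1 / 2) f)

/-- The Riesz kernel `𝓡_i(n) = π^{-1/2} ∫_0^∞ δ_i^+ G_{t,N}(n) t^{-1/2} dt`. -/
def rieszKernel {N : ℕ} (i : Fin N) (n : Fin N → ℤ) : ℝ :=
  1 / √Real.pi * ∫ t in Ioi (0 : ℝ), fwd i (heatKernel t) n * t ^ (-(1 / 2) : ℝ)

/-- The convolution `𝓡_i * f(n) = ∑_{k ∈ ℤ^N} 𝓡_i(n - k) f(k)`. -/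
def rieszConv {N : ℕ} (i : Fin N) (f : (Fin N → ℤ) → ℂ) (n : Fin N → ℤ) : ℂ :=
  ∑' k : Fin N → ℤ, (rieszKernel i (n - k) : ℂ) * f k

/-- The integrand `(δ_i^+ W_t f(n) - δ_i^+ W_t f(m)) t^{-1/2}` of the increment
`R_i f(n) - R_i f(m)`. -/
def rieszIncrementIntegrand {N : ℕ} (i : Fin N) (f : (Fin N → ℤ) → ℂ) (n m : Fin N → ℤ)
    (t : ℝ) : ℂ :=
  (fwd i (heatSemigroup t f) n - fwd i (heatSemigroup t f) m) * ((t ^ (-(1 / 2) : ℝ) : ℝ) : ℂ)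

/-- The Riesz transform modulo additive constants, normalised to vanish at the origin:
`π^{-1/2} ∫_0^∞ (δ_i^+ W_t f(n) - δ_i^+ W_t f(0)) t^{-1/2} dt`. It equals
`R_i f(n) - R_i f(0)` whenever the integrals that define `R_i f` converge. -/
def rieszModConst {N : ℕ} (i : Fin N) (f : (Fin N → ℤ) → ℂ) (n : Fin N → ℤ) : ℂ :=
  ((1 / √Real.pi : ℝ) : ℂ) * ∫ t in Ioi (0 : ℝ), rieszIncrementIntegrand i f n 0 t

/-- The length `|n| = |n_1| + ⋯ + |n_N|` on `ℤ^N`. -/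
def len {N : ℕ} (n : Fin N → ℤ) : ℝ := ∑ j, |(n j : ℝ)|

/-- The Hölder seminorm `[f]_{C^{0,α}} = sup_{n ≠ m} |f(n) - f(m)| / |n - m|^α ∈ [0, ∞]`. -/
def holderSeminorm {N : ℕ} (α : ℝ) (f : (Fin N → ℤ) → ℂ) : ℝ≥0∞ :=
  ⨆ (n : Fin N → ℤ) (m : Fin N → ℤ) (_ : n ≠ m),
    ENNReal.ofReal (‖f n - f m‖ / len (n - m) ^ α)

/-- Membership in the Hölder space `C^{0,α}(ℤ^N)`. -/
def MemHolder {N : ℕ} (α : ℝ) (f : (Fin N → ℤ) → ℂ) : Prop := holderSeminorm α f < ∞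

end

end DiscreteRiesz

namespace DiscreteRiesz

open ProbabilityTheory

/-! The heat semigroup is an expectation. The kernel at time t is the law of X - Y, where X and Y
have independent Poisson(t) coordinates, so W_t f(n) = E f(n - X + Y). The Stein–Chen identity E[(X
- t) g(X)] = t E[g(X + 1) - g(X)] is a discrete integration by parts: it moves the differences of
W_t f onto a centred weight, of L² size t^{-1/2} for one difference and t^{-1} for two. The weights
have mean zero, so f may be replaced by f - f(n), which has size [f] t^{α/2} along the walk. Hence
|δ_i W_t f| ≲ [f] t^{(α-1)/2} and |δ_j δ_i W_t f| ≲ [f] t^{α/2-1} (`norm_fwd_heatSemigroup_le`,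
`norm_fwd_fwd_heatSemigroup_le`).

With L = |n - m|, the increment integral is controlled by the first bound for t ≤ L² and by the
second, summed along a lattice path from m to n, for t > L². Both ranges give a multiple of [f] L^α
(`rieszIncrement_bound`), which is sense 3.

In sense 1 the increments of R_i f are these same integrals, by linearity. In sense 2 the estimates
justify exchanging sum and integral after one further difference δ_j. So 𝓡_i * f and the function of
sense 3 have equal forward differences and differ by a constant (`rieszConv_sub`). -/

/-- The law of `N` independent pairs of independent Poisson variables of rate `r`. -/
noncomputable def pairLaw (N : ℕ) (r : ℝ≥0) : Measure (Fin N → ℕ × ℕ) :=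
  Measure.pi fun _ => (poissonMeasure r).prod (poissonMeasure r)

instance (N : ℕ) (r : ℝ≥0) : IsProbabilityMeasure (pairLaw N r) := by
  unfold pairLaw; infer_instance

/-- The number of forward (`b = false`) or backward (`b = true`) jumps in direction `i`. -/
def jumps {N : ℕ} (b : Bool) (i : Fin N) (ω : Fin N → ℕ × ℕ) : ℕ :=
  if b then (ω i).2 else (ω i).1

/-- One additional jump in direction `i`. -/
def jump {N : ℕ} (b : Bool) (i : Fin N) : Fin N → ℕ × ℕ :=
  Pi.single i (if b then (0, 1) else (1, 0))

/-- The total displacement. -/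
def disp {N : ℕ} (ω : Fin N → ℕ × ℕ) : Fin N → ℤ := fun l => ((ω l).1 : ℤ) - (ω l).2

/-! ### Effect of one extra jump. -/

lemma jumps_add_jump_self {N : ℕ} (b : Bool) (i : Fin N) (ω : Fin N → ℕ × ℕ) :
    jumps b i (ω + jump b i) = jumps b i ω + 1 := by
  cases b <;> simp [jumps, jump]

lemma jumps_add_jump_of_ne {N : ℕ} {b c : Bool} {i j : Fin N} (h : (b, i) ≠ (c, j))
    (ω : Fin N → ℕ × ℕ) : jumps b i (ω + jump c j) = jumps b i ω := by
  by_cases hij : i = j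
  · subst hij
    cases b <;> cases c <;> simp_all [jumps, jump]
  · simp [jumps, jump, Pi.single_eq_of_ne hij]

lemma disp_add_jump_false {N : ℕ} (i : Fin N) (ω : Fin N → ℕ × ℕ) :
    disp (ω + jump false i) = disp ω + Pi.single i 1 := by
  funext l
  by_cases hij : l = i
  · subst hij; simp [disp, jump]; ring
  · simp [disp, jump, Pi.single_eq_of_ne hij]

lemma disp_add_jump_true {N : ℕ} (i : Fin N) (ω : Fin N → ℕ × ℕ) :
    disp (ω + jump true i) = disp ω - Pi.single i 1 := by
  funext l
  by_cases hij : l = i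
  · subst hij; simp [disp, jump]; ring
  · simp [disp, jump, Pi.single_eq_of_ne hij]

/-! ### The Stein–Chen identity. -/

lemma poissonMeasure_singleton_succ (r : ℝ≥0) (n : ℕ) :
    ((n + 1 : ℕ) : ℝ≥0∞) * poissonMeasure r {n + 1} = r * poissonMeasure r {n} := by
  rw [poissonMeasure_singleton, poissonMeasure_singleton, ← ENNReal.ofReal_natCast,
    ← ENNReal.ofReal_coe_nnreal, ← ENNReal.ofReal_mul (by positivity),
    ← ENNReal.ofReal_mul (by positivity)]
  congr 1
  rw [Nat.factorial_succ, pow_succ]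
  push_cast
  field_simp

lemma pairLaw_singleton (N : ℕ) (r : ℝ≥0) (ω : Fin N → ℕ × ℕ) :
    pairLaw N r {ω} = ∏ l, (poissonMeasure r {(ω l).1} * poissonMeasure r {(ω l).2}) := by
  rw [pairLaw, Measure.pi_singleton]
  refine Finset.prod_congr rfl fun l _ => ?_
  rw [← Prod.mk.eta (p := ω l), ← Set.singleton_prod_singleton, Measure.prod_prod]

lemma jumps_mul_pairLaw_singleton {N : ℕ} (r : ℝ≥0) (b : Bool) (i : Fin N)
    (ω : Fin N → ℕ × ℕ) :
    ((jumps b i ω + 1 : ℕ) : ℝ≥0∞) * pairLaw N r {ω + jump b i} = r * pairLaw N r {ω} := by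
  have hi : ((jumps b i ω + 1 : ℕ) : ℝ≥0∞) * (poissonMeasure r {((ω + jump b i) i).1} *
      poissonMeasure r {((ω + jump b i) i).2}) =
      r * (poissonMeasure r {(ω i).1} * poissonMeasure r {(ω i).2}) := by
    cases b
    · simp only [jumps, jump, Pi.add_apply, Pi.single_eq_same, Prod.fst_add, Prod.snd_add,
        Bool.false_eq_true, if_false, add_zero]
      rw [← mul_assoc, poissonMeasure_singleton_succ, mul_assoc]
    · simp only [jumps, jump, Pi.add_apply, Pi.single_eq_same, Prod.fst_add, Prod.snd_add,
        if_true, add_zero]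
      rw [mul_left_comm, poissonMeasure_singleton_succ, mul_left_comm]
  have hrest : ∀ l ∈ Finset.univ.erase i, (poissonMeasure r {((ω + jump b i) l).1} *
      poissonMeasure r {((ω + jump b i) l).2}) =
      (poissonMeasure r {(ω l).1} * poissonMeasure r {(ω l).2}) := fun l hl => by
    simp [jump, Pi.single_eq_of_ne (Finset.ne_of_mem_erase hl)]
  rw [pairLaw_singleton, pairLaw_singleton, ← Finset.mul_prod_erase _ _ (Finset.mem_univ i),
    ← Finset.mul_prod_erase _ _ (Finset.mem_univ i), Finset.prod_congr rfl hrest, ← mul_assoc, hi,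
    mul_assoc]

/-- The Stein–Chen identity for the Poisson law. -/
lemma withDensity_jumps {N : ℕ} (r : ℝ≥0) (b : Bool) (i : Fin N) :
    (pairLaw N r).withDensity (fun ω => ((jumps b i ω : ℝ≥0) : ℝ≥0∞)) =
      r • (pairLaw N r).map (· + jump b i) := by
  refine Measure.ext_of_singleton fun ω => ?_
  rw [withDensity_apply _ (measurableSet_singleton _), Measure.restrict_singleton,
    lintegral_smul_measure, lintegral_dirac, Measure.smul_apply,
    Measure.map_apply (by fun_prop) (measurableSet_singleton _), smul_eq_mul]
  -- A configuration without such a jump has no preimage under the shift, and the density vanishes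
  -- there; any other has exactly one preimage.
  by_cases h : jumps b i ω = 0
  · have : (· + jump b i) ⁻¹' {ω} = (∅ : Set (Fin N → ℕ × ℕ)) := by
      refine Set.eq_empty_of_forall_notMem fun ω' (h' : ω' + jump b i = ω) => ?_
      rw [← h', jumps_add_jump_self] at h
      omega
    rw [this]; simp [h]
  · obtain ⟨ω', rfl⟩ : ∃ ω', ω' + jump b i = ω := by
      refine ⟨ω - jump b i, ?_⟩
      funext l
      by_cases hl : l = i
      · subst hl
        cases b
        · simp only [jumps, Bool.false_eq_true, if_false] at h
          ext <;> simp [jump]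
          omega
        · simp only [jumps, if_true] at h
          ext <;> simp [jump]
          omega
      · simp [jump, Pi.single_eq_of_ne hl]
    have : (· + jump b i) ⁻¹' {ω' + jump b i} = ({ω'} : Set (Fin N → ℕ × ℕ)) := by
      ext; simp
    rw [this, jumps_add_jump_self, mul_comm]
    exact_mod_cast jumps_mul_pairLaw_singleton r b i ω'

section Stein

variable {N : ℕ} {E : Type*} [NormedAddCommGroup E] [NormedSpace ℝ E] (r : ℝ≥0) (b : Bool)
  (i : Fin N) {g : (Fin N → ℕ × ℕ) → E}

lemma integrable_jumps_smul (hg : Integrable (fun ω => g (ω + jump b i)) (pairLaw N r)) :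
    Integrable (fun ω => (jumps b i ω : ℝ) • g ω) (pairLaw N r) := by
  have h1 : Integrable g ((pairLaw N r).map (· + jump b i)) :=
    (integrable_map_measure .of_discrete .of_discrete).2 hg
  have h2 : Integrable g
      ((pairLaw N r).withDensity (fun ω => ((jumps b i ω : ℝ≥0) : ℝ≥0∞))) := by
    rw [withDensity_jumps]; exact h1.smul_measure_nnreal
  simpa [NNReal.smul_def] using
    (integrable_withDensity_iff_integrable_smul (f := fun ω => (jumps b i ω : ℝ≥0))
      .of_discrete).1 h2

lemma integral_jumps_smul :
    ∫ ω, (jumps b i ω : ℝ) • g ω ∂(pairLaw N r) =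
      (r : ℝ) • ∫ ω, g (ω + jump b i) ∂(pairLaw N r) := by
  have := integral_withDensity_eq_integral_smul (μ := pairLaw N r)
    (f := fun ω => (jumps b i ω : ℝ≥0)) .of_discrete g
  rw [withDensity_jumps, integral_smul_nnreal_measure,
    integral_map .of_discrete .of_discrete] at this
  simpa [NNReal.smul_def] using this.symm

lemma integrable_jumps_sub_smul (hg : Integrable g (pairLaw N r))
    (hg' : Integrable (fun ω => g (ω + jump b i)) (pairLaw N r)) :
    Integrable (fun ω => ((jumps b i ω : ℝ) - r) • g ω) (pairLaw N r) := by
  simp only [sub_smul]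
  exact (integrable_jumps_smul r b i hg').sub (hg.smul (r : ℝ))

/-- Discrete integration by parts: read from right to left, it trades a difference of g for
multiplication by the centred number of jumps. -/
lemma integral_jumps_sub_smul (hg : Integrable g (pairLaw N r))
    (hg' : Integrable (fun ω => g (ω + jump b i)) (pairLaw N r)) :
    ∫ ω, ((jumps b i ω : ℝ) - r) • g ω ∂(pairLaw N r) =
      (r : ℝ) • (∫ ω, g (ω + jump b i) ∂(pairLaw N r) - ∫ ω, g ω ∂(pairLaw N r)) := by
  simp only [sub_smul]
  rw [integral_sub (integrable_jumps_smul r b i hg') (by exact hg.smul (r : ℝ)),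
    integral_jumps_smul,
    integral_smul, smul_sub]

end Stein

/-! ### Second moments of the centred jump counts. -/

section Moments

variable {N : ℕ} (r : ℝ≥0) (b c : Bool) (i j : Fin N)

/-- The centred number of jumps. -/
noncomputable def centred (ω : Fin N → ℕ × ℕ) : ℝ := (jumps b i ω : ℝ) - r

lemma centred_add_jump_self (ω : Fin N → ℕ × ℕ) :
    centred r b i (ω + jump b i) = centred r b i ω + 1 := by
  simp only [centred, jumps_add_jump_self]; push_cast; ring

variable {b c i j} in
lemma centred_add_jump_of_ne (h : (b, i) ≠ (c, j)) (ω : Fin N → ℕ × ℕ) :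
    centred r b i (ω + jump c j) = centred r b i ω := by
  simp only [centred, jumps_add_jump_of_ne h]

lemma integrable_centred : Integrable (centred r b i) (pairLaw N r) := by
  have h := integrable_jumps_sub_smul r b i (g := fun _ => (1 : ℝ))
    (integrable_const _) (integrable_const _)
  simp only [smul_eq_mul, mul_one] at h
  exact h

lemma integral_centred : ∫ ω, centred r b i ω ∂(pairLaw N r) = 0 := by
  simpa [centred] using integral_jumps_sub_smul r b i (g := fun _ => (1 : ℝ))
    (integrable_const _) (integrable_const _)

lemma integrable_centred_sq : Integrable (fun ω => centred r b i ω ^ 2) (pairLaw N r) := by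
  have h := integrable_centred r b i
  simpa [centred, sq] using integrable_jumps_sub_smul r b i (g := centred r b i) h
    (by simp only [centred_add_jump_self]; exact h.add (integrable_const 1))

lemma integral_centred_sq : ∫ ω, centred r b i ω ^ 2 ∂(pairLaw N r) = r := by
  have h := integrable_centred r b i
  have h' : Integrable (fun ω => centred r b i ω + 1) (pairLaw N r) :=
    h.add (integrable_const 1)
  have := integral_jumps_sub_smul r b i (g := centred r b i) h
    (by simpa only [centred_add_jump_self] using h')
  simp only [centred_add_jump_self] at this
  rw [integral_add h (integrable_const 1)] at this
  simpa [centred, sq] using this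

variable {b c i j}

lemma integrable_centred_mul_centred_sq (h : (b, i) ≠ (c, j)) :
    Integrable (fun ω => centred r b i ω * centred r c j ω ^ 2) (pairLaw N r) := by
  have h1 := integrable_centred_sq r c j
  simpa [centred] using integrable_jumps_sub_smul r b i (g := fun ω => centred r c j ω ^ 2) h1
    (by simpa only [centred_add_jump_of_ne r h.symm] using h1)

lemma integrable_centred_sq_mul_centred_sq (h : (b, i) ≠ (c, j)) :
    Integrable (fun ω => (centred r b i ω * centred r c j ω) ^ 2) (pairLaw N r) := by
  have h1 := integrable_centred_mul_centred_sq r h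
  have h2 := integrable_centred_sq r c j
  have := integrable_jumps_sub_smul r b i
    (g := fun ω => centred r b i ω * centred r c j ω ^ 2) h1
    (by simp only [centred_add_jump_of_ne r h.symm, centred_add_jump_self, add_mul, one_mul]
        exact h1.add h2)
  refine this.congr (ae_of_all _ fun ω => ?_)
  simp only [centred, smul_eq_mul]; ring

/-- A jump of one kind leaves the other count unchanged, so Stein–Chen applied to one factor reduces
this to the variance of the other. -/
lemma integral_centred_sq_mul_centred_sq (h : (b, i) ≠ (c, j)) :
    ∫ ω, (centred r b i ω * centred r c j ω) ^ 2 ∂(pairLaw N r) = (r : ℝ) ^ 2 := by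
  have h1 := integrable_centred_mul_centred_sq r h
  have h2 := integrable_centred_sq r c j
  have h3 : Integrable (fun ω => centred r b i ω * centred r c j ω ^ 2 + centred r c j ω ^ 2)
    (pairLaw N r) := h1.add h2
  have := integral_jumps_sub_smul r b i
    (g := fun ω => centred r b i ω * centred r c j ω ^ 2) h1
    (by simpa only [centred_add_jump_of_ne r h.symm, centred_add_jump_self, add_mul, one_mul]
      using h3)
  simp only [centred_add_jump_of_ne r h.symm, centred_add_jump_self, add_mul, one_mul] at this
  rw [integral_add h1 h2, integral_centred_sq] at this
  calc _ = _ := integral_congr_ae (ae_of_all _ fun ω => by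
        simp only [centred, smul_eq_mul]; ring)
    _ = _ := this
    _ = _ := by simp; ring

end Moments

/-! ### L² weights against the displacement at scale √r. -/

section WeightedDisplacement

variable {N : ℕ} {r : ℝ≥0}

lemma len_nonneg (n : Fin N → ℤ) : 0 ≤ len n := Finset.sum_nonneg fun _ _ => abs_nonneg _

lemma len_disp_le (ω : Fin N → ℕ × ℕ) :
    len (disp ω) ≤ ∑ l, (|centred r false l ω| + |centred r true l ω|) := by
  refine Finset.sum_le_sum fun l _ => ?_
  have : ((disp ω l : ℤ) : ℝ) = centred r false l ω - centred r true l ω := by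
    simp [disp, centred, jumps]
  rw [this]
  exact abs_sub _ _

/-- The majorant of `|B| (1 + |Z| / √r)` that comes from the inequality of the means. -/
lemma abs_mul_one_add_len_le {β : ℝ} (hβ : 0 < β) (hr : 0 < r) (x : ℝ) (ω : Fin N → ℕ × ℕ) :
    |x| * (1 + len (disp ω) / √r) ≤ (1 / 2) * (x ^ 2 / β + β) +
      ∑ l, ((1 / 2) * (x ^ 2 / β + β * (centred r false l ω ^ 2 / r)) +
        (1 / 2) * (x ^ 2 / β + β * (centred r true l ω ^ 2 / r))) := by
  have key : ∀ y : ℝ, |x| * |y| ≤ (1 / 2) * (x ^ 2 / β + β * y ^ 2) := fun y => by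
    have h : 0 ≤ (|x| - β * |y|) ^ 2 / β := by positivity
    have e : (|x| - β * |y|) ^ 2 / β = x ^ 2 / β - 2 * (|x| * |y|) + β * y ^ 2 := by
      rw [← sq_abs x, ← sq_abs y]; field_simp; ring
    linarith
  have hs : (0 : ℝ) < √r := Real.sqrt_pos.2 (by exact_mod_cast hr)
  have key2 : ∀ y : ℝ, |x| * (|y| / √r) ≤ (1 / 2) * (x ^ 2 / β + β * (y ^ 2 / r)) := fun y => by
    have := key (y / √r)
    rwa [abs_div, abs_of_pos hs, div_pow, Real.sq_sqrt (by positivity)] at this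
  rw [mul_add, mul_one]
  refine add_le_add (by simpa using key 1) ?_
  calc |x| * (len (disp ω) / √r)
      ≤ |x| * ((∑ l, (|centred r false l ω| + |centred r true l ω|)) / √r) := by
        gcongr; exact len_disp_le ω
    _ = ∑ l, (|x| * (|centred r false l ω| / √r) + |x| * (|centred r true l ω| / √r)) := by
        rw [Finset.sum_div, Finset.mul_sum]
        exact Finset.sum_congr rfl fun l _ => by ring
    _ ≤ _ := Finset.sum_le_sum fun l _ => add_le_add (key2 _) (key2 _)

variable {B : (Fin N → ℕ × ℕ) → ℝ} {β : ℝ}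

lemma integrable_mul_one_add_len (hr : 0 < r) (hB : Integrable (fun ω => B ω ^ 2) (pairLaw N r)) :
    Integrable (fun ω => |B ω| * (1 + len (disp ω) / √r)) (pairLaw N r) := by
  have hmaj : Integrable (fun ω => (1 / 2) * (B ω ^ 2 / 1 + 1) +
      ∑ l, ((1 / 2) * (B ω ^ 2 / 1 + 1 * (centred r false l ω ^ 2 / r)) +
        (1 / 2) * (B ω ^ 2 / 1 + 1 * (centred r true l ω ^ 2 / r)))) (pairLaw N r) := by
    refine (((hB.div_const 1).add (integrable_const 1)).const_mul _).add
      (integrable_finsetSum _ fun l _ => ?_)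
    exact (((hB.div_const 1).add (((integrable_centred_sq r _ l).div_const _).const_mul _)).const_mul
      _).add (((hB.div_const 1).add
        (((integrable_centred_sq r _ l).div_const _).const_mul _)).const_mul _)
  refine hmaj.mono' .of_discrete (ae_of_all _ fun ω => ?_)
  have := len_nonneg (disp ω)
  rw [Real.norm_of_nonneg (by positivity)]
  exact abs_mul_one_add_len_le one_pos hr _ ω

/-- The term 1 and each of the 2N centred counts, normalised by √r, have second moment 1. Paired
with B by the inequality of the means, each contributes at most β. -/
lemma integral_mul_one_add_len_le (hr : 0 < r) (hβ : 0 < β)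
    (hB : Integrable (fun ω => B ω ^ 2) (pairLaw N r))
    (hB2 : ∫ ω, B ω ^ 2 ∂(pairLaw N r) ≤ β ^ 2) :
    ∫ ω, |B ω| * (1 + len (disp ω) / √r) ∂(pairLaw N r) ≤ (1 + 2 * N) * β := by
  have hr' : (0 : ℝ) < r := by exact_mod_cast hr
  have h0 : Integrable (fun ω => (1 / 2) * (B ω ^ 2 / β + β)) (pairLaw N r) :=
    ((hB.div_const β).add (integrable_const β)).const_mul _
  have h1 : ∀ b l, Integrable (fun ω => (1 / 2) * (B ω ^ 2 / β + β * (centred r b l ω ^ 2 / r)))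
      (pairLaw N r) := fun b l =>
    ((hB.div_const β).add (((integrable_centred_sq r b l).div_const _).const_mul _)).const_mul _
  have hdiv : (∫ ω, B ω ^ 2 ∂(pairLaw N r)) / β ≤ β := by
    rw [div_le_iff₀ hβ]; linarith [sq β]
  have e0 : ∫ ω, (1 / 2) * (B ω ^ 2 / β + β) ∂(pairLaw N r) ≤ β := by
    rw [integral_const_mul, integral_add (hB.div_const β) (integrable_const β), integral_div]
    simp
    linarith
  have e1 : ∀ b l, ∫ ω, (1 / 2) * (B ω ^ 2 / β + β * (centred r b l ω ^ 2 / r)) ∂(pairLaw N r)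
      ≤ β := fun b l => by
    rw [integral_const_mul, integral_add (hB.div_const β)
      (((integrable_centred_sq r b l).div_const _).const_mul _), integral_div,
      integral_const_mul, integral_div, integral_centred_sq, div_self hr'.ne']
    linarith
  have h2 : ∀ l, Integrable (fun ω => (1 / 2) * (B ω ^ 2 / β + β * (centred r false l ω ^ 2 / r)) +
      (1 / 2) * (B ω ^ 2 / β + β * (centred r true l ω ^ 2 / r))) (pairLaw N r) := fun l =>
    (h1 false l).add (h1 true l)
  calc _ ≤ ∫ ω, ((1 / 2) * (B ω ^ 2 / β + β) +
        ∑ l, ((1 / 2) * (B ω ^ 2 / β + β * (centred r false l ω ^ 2 / r)) +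
        (1 / 2) * (B ω ^ 2 / β + β * (centred r true l ω ^ 2 / r)))) ∂(pairLaw N r) :=
        integral_mono (integrable_mul_one_add_len hr hB)
          (h0.add (integrable_finsetSum _ fun l _ => h2 l))
          fun ω => abs_mul_one_add_len_le hβ hr _ ω
    _ ≤ β + ∑ _l : Fin N, (β + β) := by
        rw [integral_add h0 (integrable_finsetSum _ fun l _ => h2 l),
          integral_finsetSum _ fun l _ => h2 l]
        refine add_le_add e0 (Finset.sum_le_sum fun l _ => ?_)
        rw [integral_add (h1 false l) (h1 true l)]
        exact add_le_add (e1 _ _) (e1 _ _)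
    _ = _ := by simp; ring

end WeightedDisplacement

/-! ### The heat kernel as the law of the displacement. -/

section HeatKernel

/-- Conditioning on the second variable being k forces the first to be m + k; the resulting series
is that of the Bessel function, term by term. -/
lemma poissonDifference_eq_besselI {t : ℝ} (ht : 0 < t) (m : ℤ) :
    ((poissonMeasure t.toNNReal).prod (poissonMeasure t.toNNReal)).real
      {p | (p.1 : ℤ) - p.2 = m} = Real.exp (-2 * t) * besselI m (2 * t) := by
  have hcoe : ((t.toNNReal : ℝ≥0) : ℝ) = t := Real.coe_toNNReal t ht.le
  rw [measureReal_def, Measure.prod_apply_symm .of_discrete, lintegral_countable',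
    ENNReal.tsum_toReal_eq fun a => ENNReal.mul_ne_top (measure_ne_top _ _) (measure_ne_top _ _),
    besselI, ← tsum_mul_left]
  refine tsum_congr fun k => ?_
  rw [ENNReal.toReal_mul, ← measureReal_def, ← measureReal_def, poissonMeasure_real_singleton, hcoe]
  by_cases h : 0 ≤ m + k
  · obtain ⟨a, ha⟩ := Int.eq_ofNat_of_zero_le h
    have hset : ((fun x : ℕ => (x, k)) ⁻¹' {p : ℕ × ℕ | (p.1 : ℤ) - p.2 = m}) = {a} := by
      ext x; simp only [mem_preimage, mem_ofPred_eq, mem_singleton_iff]; omega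
    have hm : (m : ℝ) + k = a := by exact_mod_cast ha
    have hexp : Real.exp (-2 * t) = Real.exp (-t) * Real.exp (-t) := by
      rw [← Real.exp_add]; ring_nf
    have hpow : (2 * t / 2) ^ (2 * (k : ℝ) + m) = t ^ a * t ^ k := by
      rw [show 2 * (k : ℝ) + m = ((a + k : ℕ) : ℝ) by push_cast; linarith, Real.rpow_natCast,
        pow_add]
      congr 2 <;> ring
    rw [hset, poissonMeasure_real_singleton, hcoe, hpow, hm, Real.Gamma_nat_eq_factorial, hexp]
    field_simp
  -- For m + k < 0 no first coordinate exists, and the Bessel term vanishes because `Real.Gamma` is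
  -- 0 at nonpositive integers.
  · have hset : ((fun x : ℕ => (x, k)) ⁻¹' {p : ℕ × ℕ | (p.1 : ℤ) - p.2 = m}) = ∅ := by
      refine Set.eq_empty_of_forall_notMem fun x hx => ?_
      have hx' : (x : ℤ) - k = m := hx
      omega
    obtain ⟨q, hq⟩ := Int.eq_ofNat_of_zero_le (show 0 ≤ -(m + k + 1) by omega)
    have hG : Real.Gamma ((m : ℝ) + k + 1) = 0 := by
      rw [show (m : ℝ) + k + 1 = -(q : ℝ) by
        have : ((-(m + k + 1) : ℤ) : ℝ) = q := by exact_mod_cast hq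
        push_cast at this; linarith]
      exact Real.Gamma_neg_nat_eq_zero q
    rw [hset, hG]; simp

variable {N : ℕ} {t : ℝ}

lemma heatKernel_eq_measure (ht : 0 < t) (n : Fin N → ℤ) :
    heatKernel t n = (pairLaw N t.toNNReal).real (disp ⁻¹' {n}) := by
  have hset : (disp ⁻¹' {n} : Set (Fin N → ℕ × ℕ)) =
      Set.univ.pi fun l => {p : ℕ × ℕ | (p.1 : ℤ) - p.2 = n l} := by
    ext ω; simp [disp, funext_iff]
  rw [hset, measureReal_def, pairLaw, Measure.pi_pi, ENNReal.toReal_prod, heatKernel]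
  exact Finset.prod_congr rfl fun l _ => (poissonDifference_eq_besselI ht (n l)).symm

lemma hasSum_heatKernel_mul (ht : 0 < t) {f : (Fin N → ℤ) → ℂ} {n : Fin N → ℤ}
    (hf : Integrable (fun ω => f (n - disp ω)) (pairLaw N t.toNNReal)) :
    HasSum (fun k => (heatKernel t (n - k) : ℂ) * f k)
      (∫ ω, f (n - disp ω) ∂(pairLaw N t.toNNReal)) := by
  have h1 : Integrable (fun k => f (n - k)) ((pairLaw N t.toNNReal).map disp) :=
    (integrable_map_measure .of_discrete .of_discrete).2 hf
  have h2 := h1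
  rw [← Measure.sum_smul_dirac ((pairLaw N t.toNNReal).map disp)] at h2
  have h3 := hasSum_integral_measure h2
  rw [Measure.sum_smul_dirac, integral_map .of_discrete .of_discrete] at h3
  rw [← (Equiv.subLeft n).hasSum_iff]
  convert! h3 using 2 with k
  rw [integral_smul_measure, integral_dirac, Complex.real_smul, ← measureReal_def,
    map_measureReal_apply .of_discrete (measurableSet_singleton k), ← heatKernel_eq_measure ht]
  simp

lemma heatSemigroup_eq_integral (ht : 0 < t) {f : (Fin N → ℤ) → ℂ} {n : Fin N → ℤ}
    (hf : Integrable (fun ω => f (n - disp ω)) (pairLaw N t.toNNReal)) :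
    heatSemigroup t f n = ∫ ω, f (n - disp ω) ∂(pairLaw N t.toNNReal) :=
  (hasSum_heatKernel_mul ht hf).tsum_eq

end HeatKernel

/-! ### Decay of first and second differences of the semigroup. -/

section Holder

variable {N : ℕ} {t α K : ℝ} {f : (Fin N → ℤ) → ℂ}

/-- At the diffusive scale √t this is x^α ≤ 1 + x, which makes second moments of the displacement
sufficient. -/
lemma len_rpow_le (ht : 0 < t) (hα0 : 0 < α) (hα1 : α < 1) (n : Fin N → ℤ) :
    len n ^ α ≤ t ^ (α / 2) * (1 + len n / √t) := by
  have hs : 0 < √t := Real.sqrt_pos.2 ht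
  have hx : 0 ≤ len n / √t := div_nonneg (len_nonneg n) hs.le
  have h : (len n / √t) ^ α ≤ 1 + len n / √t := by
    rcases le_total (len n / √t) 1 with h1 | h1
    · exact (Real.rpow_le_one hx h1 hα0.le).trans (by linarith)
    · exact (Real.rpow_le_self_of_one_le h1 hα1.le).trans (by linarith)
  calc len n ^ α = (√t * (len n / √t)) ^ α := by rw [mul_div_cancel₀ _ hs.ne']
    _ = t ^ (α / 2) * (len n / √t) ^ α := by
      rw [Real.mul_rpow hs.le hx, Real.sqrt_eq_rpow, ← Real.rpow_mul ht.le]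
      congr 2; ring
    _ ≤ _ := by gcongr

/-- The Hölder condition with explicit constant. -/
def HolderBound (α K : ℝ) (f : (Fin N → ℤ) → ℂ) : Prop :=
  ∀ n m, ‖f n - f m‖ ≤ K * len (n - m) ^ α

lemma len_neg (n : Fin N → ℤ) : len (-n) = len n := by simp [len]

lemma HolderBound.norm_disp_le (hf : HolderBound α K f) (hK : 0 ≤ K) (ht : 0 < t)
    (hα0 : 0 < α) (hα1 : α < 1) (n : Fin N → ℤ) (ω : Fin N → ℕ × ℕ) :
    ‖f (n - disp ω)‖ ≤ (‖f n‖ + K * t ^ (α / 2)) * (1 + len (disp ω) / √t) := by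
  have h0 : 0 ≤ len (disp ω) / √t := div_nonneg (len_nonneg _) (Real.sqrt_nonneg _)
  have h1 : ‖f (n - disp ω) - f n‖ ≤ K * (t ^ (α / 2) * (1 + len (disp ω) / √t)) := by
    refine (hf _ _).trans ?_
    rw [sub_sub_cancel_left, len_neg]
    gcongr
    exact len_rpow_le ht hα0 hα1 _
  have h2 : ‖f (n - disp ω)‖ ≤ ‖f n‖ + ‖f (n - disp ω) - f n‖ := by
    simpa using norm_add_le (f n) (f (n - disp ω) - f n)
  nlinarith [mul_nonneg (norm_nonneg (f n)) h0]

variable {B : (Fin N → ℕ × ℕ) → ℝ} {β : ℝ}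

lemma integrable_smul_holder (hf : HolderBound α K f) (hK : 0 ≤ K) (ht : 0 < t)
    (hα0 : 0 < α) (hα1 : α < 1) (n : Fin N → ℤ)
    (hB : Integrable (fun ω => B ω ^ 2) (pairLaw N t.toNNReal)) :
    Integrable (fun ω => B ω • f (n - disp ω)) (pairLaw N t.toNNReal) := by
  have hI := integrable_mul_one_add_len (Real.toNNReal_pos.2 ht) hB
  refine (hI.const_mul (‖f n‖ + K * t ^ (α / 2))).mono' .of_discrete (ae_of_all _ fun ω => ?_)
  rw [norm_smul, Real.norm_eq_abs, Real.coe_toNNReal t ht.le, mul_left_comm]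
  gcongr
  exact hf.norm_disp_le hK ht hα0 hα1 n ω

lemma integrable_holder (hf : HolderBound α K f) (hK : 0 ≤ K) (ht : 0 < t)
    (hα0 : 0 < α) (hα1 : α < 1) (n : Fin N → ℤ) :
    Integrable (fun ω => f (n - disp ω)) (pairLaw N t.toNNReal) := by
  simpa using integrable_smul_holder (B := fun _ => 1) hf hK ht hα0 hα1 n (integrable_const _)

lemma integral_norm_smul_le (hf : HolderBound α K f) (hK : 0 ≤ K) (ht : 0 < t)
    (hα0 : 0 < α) (hα1 : α < 1) (n : Fin N → ℤ) (hβ : 0 < β)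
    (hB : Integrable (fun ω => B ω ^ 2) (pairLaw N t.toNNReal))
    (hB2 : ∫ ω, B ω ^ 2 ∂(pairLaw N t.toNNReal) ≤ β ^ 2) :
    ∫ ω, ‖B ω • f (n - disp ω)‖ ∂(pairLaw N t.toNNReal) ≤
      (‖f n‖ + K * t ^ (α / 2)) * ((1 + 2 * N) * β) := by
  have hr := Real.toNNReal_pos.2 ht
  refine le_trans ?_ (mul_le_mul_of_nonneg_left (integral_mul_one_add_len_le hr hβ hB hB2)
    (by positivity))
  rw [← integral_const_mul]
  refine integral_mono_of_nonneg (ae_of_all _ fun ω => by positivity)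
    ((integrable_mul_one_add_len hr hB).const_mul _) (ae_of_all _ fun ω => ?_)
  dsimp only
  rw [norm_smul, Real.norm_eq_abs, mul_left_comm, Real.coe_toNNReal t ht.le]
  gcongr
  exact hf.norm_disp_le hK ht hα0 hα1 n ω

/-- A mean-zero weight sees only f - f(n), which removes the term ‖f n‖ and leaves the oscillation.
-/
lemma norm_integral_smul_le (hf : HolderBound α K f) (hK : 0 ≤ K) (ht : 0 < t)
    (hα0 : 0 < α) (hα1 : α < 1) (n : Fin N → ℤ) (hβ : 0 < β)
    (hB : Integrable (fun ω => B ω ^ 2) (pairLaw N t.toNNReal))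
    (hB2 : ∫ ω, B ω ^ 2 ∂(pairLaw N t.toNNReal) ≤ β ^ 2)
    (hB1 : Integrable B (pairLaw N t.toNNReal))
    (hB0 : ∫ ω, B ω ∂(pairLaw N t.toNNReal) = 0) :
    ‖∫ ω, B ω • f (n - disp ω) ∂(pairLaw N t.toNNReal)‖ ≤
      K * t ^ (α / 2) * ((1 + 2 * N) * β) := by
  have h : ∫ ω, B ω • f (n - disp ω) ∂(pairLaw N t.toNNReal) =
      ∫ ω, B ω • (f (n - disp ω) - f n) ∂(pairLaw N t.toNNReal) := by
    simp only [smul_sub]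
    rw [integral_sub (integrable_smul_holder hf hK ht hα0 hα1 n hB) (hB1.smul_const _),
      integral_smul_const, hB0, zero_smul, sub_zero]
  have hf' : HolderBound α K fun k => f k - f n := fun k l => by simpa using hf k l
  rw [h]
  simpa using (norm_integral_le_integral_norm _).trans
    (integral_norm_smul_le hf' hK ht hα0 hα1 n hβ hB hB2)

/-- The weight that represents the difference of the heat semigroup in direction `i`. -/
noncomputable def weight (t : ℝ) (i : Fin N) (ω : Fin N → ℕ × ℕ) : ℝ :=
  centred t.toNNReal true i ω / t

/-- The weight that represents the mixed second difference of the heat semigroup. -/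
noncomputable def weight₂ (t : ℝ) (i j : Fin N) (ω : Fin N → ℕ × ℕ) : ℝ :=
  -(centred t.toNNReal false j ω * centred t.toNNReal true i ω) / t ^ 2

lemma integrable_weight (i : Fin N) : Integrable (weight t i) (pairLaw N t.toNNReal) :=
  (integrable_centred _ _ _).div_const _

lemma integral_weight (i : Fin N) : ∫ ω, weight t i ω ∂(pairLaw N t.toNNReal) = 0 := by
  simp only [weight]; rw [integral_div, integral_centred, zero_div]

lemma integrable_weight_sq (i : Fin N) :
    Integrable (fun ω => weight t i ω ^ 2) (pairLaw N t.toNNReal) := by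
  simp only [weight, div_pow]
  exact (integrable_centred_sq _ _ _).div_const _

lemma integral_weight_sq (ht : 0 < t) (i : Fin N) :
    ∫ ω, weight t i ω ^ 2 ∂(pairLaw N t.toNNReal) = (t ^ (-(1 / 2) : ℝ)) ^ 2 := by
  simp only [weight, div_pow]
  rw [integral_div, integral_centred_sq, Real.coe_toNNReal t ht.le,
    ← Real.rpow_natCast (t ^ (-(1 / 2) : ℝ)), ← Real.rpow_mul ht.le,
    show (-(1 / 2) : ℝ) * (2 : ℕ) = -1 by norm_num, Real.rpow_neg_one]
  field_simp

lemma integrable_weight₂_sq (i j : Fin N) :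
    Integrable (fun ω => weight₂ t i j ω ^ 2) (pairLaw N t.toNNReal) := by
  simp only [weight₂, div_pow, neg_sq]
  exact (integrable_centred_sq_mul_centred_sq _ (by simp)).div_const _

lemma integral_weight₂_sq (ht : 0 < t) (i j : Fin N) :
    ∫ ω, weight₂ t i j ω ^ 2 ∂(pairLaw N t.toNNReal) = (t⁻¹) ^ 2 := by
  simp only [weight₂, div_pow, neg_sq]
  rw [integral_div, integral_centred_sq_mul_centred_sq _ (by simp), Real.coe_toNNReal t ht.le]
  field_simp

/-- A backward jump lowers the displacement by e_i, hence moves the argument of f to n + e_i;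
Stein–Chen turns this shift into the weight. -/
lemma fwd_heatSemigroup (hf : HolderBound α K f) (hK : 0 ≤ K) (ht : 0 < t)
    (hα0 : 0 < α) (hα1 : α < 1) (i : Fin N) (n : Fin N → ℤ) :
    fwd i (heatSemigroup t f) n =
      ∫ ω, weight t i ω • f (n - disp ω) ∂(pairLaw N t.toNNReal) := by
  have hI := fun n => integrable_holder hf hK ht hα0 hα1 n
  have hshift : ∀ ω, f (n - disp (ω + jump true i)) = f (n + Pi.single i 1 - disp ω) := fun ω => by
    rw [disp_add_jump_true]; congr 1; abel
  have h := integral_jumps_sub_smul t.toNNReal true i (g := fun ω => f (n - disp ω)) (hI n)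
    (by simp only [hshift]; exact hI _)
  simp only [hshift, Real.coe_toNNReal t ht.le] at h
  rw [fwd, heatSemigroup_eq_integral ht (hI _), heatSemigroup_eq_integral ht (hI _),
    ← inv_smul_smul₀ ht.ne' (_ - _), ← h, ← integral_smul]
  refine integral_congr_ae (ae_of_all _ fun ω => ?_)
  simp only [smul_smul, weight, centred, Real.coe_toNNReal t ht.le]
  congr 1; ring

/-- The second integration by parts uses forward jumps, which do not affect the first weight even
when i = j, so there is no diagonal term. A forward jump moves the argument back by e_j: hence the
base point n + e_j and the sign in `weight₂`. -/
lemma fwd_fwd_heatSemigroup (hf : HolderBound α K f) (hK : 0 ≤ K) (ht : 0 < t)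
    (hα0 : 0 < α) (hα1 : α < 1) (i j : Fin N) (n : Fin N → ℤ) :
    fwd j (fwd i (heatSemigroup t f)) n =
      ∫ ω, weight₂ t i j ω • f (n + Pi.single j 1 - disp ω) ∂(pairLaw N t.toNNReal) := by
  have hI := fun n => integrable_smul_holder hf hK ht hα0 hα1 n (integrable_weight_sq i)
  have hshift : ∀ ω, weight t i (ω + jump false j) •
      f (n + Pi.single j 1 - disp (ω + jump false j)) = weight t i ω • f (n - disp ω) := fun ω => by
    rw [disp_add_jump_false, weight, centred_add_jump_of_ne _ (by simp), ← weight]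
    congr 2; abel
  have h := integral_jumps_sub_smul t.toNNReal false j
    (g := fun ω => weight t i ω • f (n + Pi.single j 1 - disp ω)) (hI _)
    (by simp only [hshift]; exact hI _)
  simp only [hshift, Real.coe_toNNReal t ht.le] at h
  rw [fwd, fwd_heatSemigroup hf hK ht hα0 hα1, fwd_heatSemigroup hf hK ht hα0 hα1,
    ← neg_sub, ← inv_smul_smul₀ ht.ne' (_ - _), ← h, ← integral_smul, ← integral_neg]
  refine integral_congr_ae (ae_of_all _ fun ω => ?_)
  simp only [smul_smul, weight, weight₂, centred, Real.coe_toNNReal t ht.le, ← neg_smul]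
  congr 1; field_simp

lemma integrable_weight₂ (i j : Fin N) :
    Integrable (weight₂ t i j) (pairLaw N t.toNNReal) :=
  ((memLp_two_iff_integrable_sq .of_discrete).2 (integrable_weight₂_sq i j)).integrable
    (by norm_num)

lemma integral_weight₂ (ht : 0 < t) (i j : Fin N) :
    ∫ ω, weight₂ t i j ω ∂(pairLaw N t.toNNReal) = 0 := by
  -- Test the representation on f = 1: W_t 1 = 1, so its second difference is zero.
  have hc : HolderBound (N := N) (1 / 2) 0 (fun _ => 1) := fun n m => by simp
  have h1 := fwd_fwd_heatSemigroup hc le_rfl ht (by norm_num) (by norm_num) i j 0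
  have h2 : ∀ n : Fin N → ℤ, heatSemigroup t (fun _ => 1) n = 1 := fun n => by
    rw [heatSemigroup_eq_integral ht (integrable_const _)]; simp
  have h3 : fwd j (fwd i (heatSemigroup t fun _ : Fin N → ℤ => (1 : ℂ))) 0 = 0 := by
    simp [fwd, h2]
  rw [h3, integral_smul_const] at h1
  simpa using h1.symm

lemma norm_fwd_heatSemigroup_le (hf : HolderBound α K f) (hK : 0 ≤ K) (ht : 0 < t)
    (hα0 : 0 < α) (hα1 : α < 1) (i : Fin N) (n : Fin N → ℤ) :
    ‖fwd i (heatSemigroup t f) n‖ ≤ K * (1 + 2 * N) * t ^ ((α - 1) / 2) := by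
  rw [fwd_heatSemigroup hf hK ht hα0 hα1]
  refine (norm_integral_smul_le hf hK ht hα0 hα1 n (β := t ^ (-(1 / 2) : ℝ)) (by positivity)
    (integrable_weight_sq i) (integral_weight_sq ht i).le (integrable_weight i)
    (integral_weight i)).trans (le_of_eq ?_)
  rw [show (α - 1) / 2 = α / 2 + -(1 / 2) by ring, Real.rpow_add ht]; ring

lemma norm_fwd_fwd_heatSemigroup_le (hf : HolderBound α K f) (hK : 0 ≤ K) (ht : 0 < t)
    (hα0 : 0 < α) (hα1 : α < 1) (i j : Fin N) (n : Fin N → ℤ) :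
    ‖fwd j (fwd i (heatSemigroup t f)) n‖ ≤ K * (1 + 2 * N) * t ^ (α / 2 - 1) := by
  rw [fwd_fwd_heatSemigroup hf hK ht hα0 hα1]
  refine (norm_integral_smul_le hf hK ht hα0 hα1 _ (β := t⁻¹) (by positivity)
    (integrable_weight₂_sq i j) (integral_weight₂_sq ht i j).le (integrable_weight₂ i j)
    (integral_weight₂ ht i j)).trans (le_of_eq ?_)
  rw [Real.rpow_sub_one ht.ne']; ring

end Holder

/-! ### Measurability in time. -/

section Measurability

variable {N : ℕ} {α K : ℝ} {f : (Fin N → ℤ) → ℂ}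

lemma measurable_heatKernel (n : Fin N → ℤ) : Measurable fun t => heatKernel t n := by
  refine Finset.measurable_prod _ fun l _ => Measurable.mul (by fun_prop) ?_
  exact Measurable.tsum fun k => by fun_prop

lemma aestronglyMeasurable_heatSemigroup (hf : HolderBound α K f) (hK : 0 ≤ K)
    (hα0 : 0 < α) (hα1 : α < 1) (n : Fin N → ℤ) :
    AEStronglyMeasurable (fun t => heatSemigroup t f n) (volume.restrict (Ioi (0 : ℝ))) := by
  refine aestronglyMeasurable_of_tendsto_ae (Filter.atTop : Filter (Finset (Fin N → ℤ)))
    (f := fun s t => ∑ k ∈ s, (heatKernel t (n - k) : ℂ) * f k) (fun s => ?_) ?_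
  · refine Finset.aestronglyMeasurable_fun_sum _ fun k _ => ?_
    exact ((measurable_heatKernel _).complex_ofReal.mul_const _).aestronglyMeasurable
  · filter_upwards [ae_restrict_mem measurableSet_Ioi] with t ht
    have h := integrable_holder hf hK ht hα0 hα1 n
    rw [heatSemigroup_eq_integral ht h]
    exact hasSum_heatKernel_mul ht h

end Measurability

/-! ### From one-step differences to increments along lattice paths. -/

section Paths

lemma one_le_len {N : ℕ} {n : Fin N → ℤ} (hn : n ≠ 0) : 1 ≤ len n := by
  obtain ⟨l, hl⟩ := Function.ne_iff.1 hn
  have h1 : (1 : ℝ) ≤ |(n l : ℝ)| := by exact_mod_cast Int.one_le_abs hl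
  exact h1.trans (Finset.single_le_sum (f := fun j => |(n j : ℝ)|) (fun _ _ => abs_nonneg _)
    (Finset.mem_univ l))

lemma len_pos {N : ℕ} {n : Fin N → ℤ} (hn : n ≠ 0) : 0 < len n :=
  one_pos.trans_le (one_le_len hn)


variable {N : ℕ} {E : Type*} [NormedAddCommGroup E] {g : (Fin N → ℤ) → E} {M : ℝ}

lemma norm_add_single_sub_le (hg : ∀ j n, ‖fwd j g n‖ ≤ M) (j : Fin N) (n : Fin N → ℤ) (k : ℤ) :
    ‖g (n + Pi.single j k) - g n‖ ≤ M * |(k : ℝ)| := by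
  have hnat : ∀ (k : ℕ) (n : Fin N → ℤ), ‖g (n + Pi.single j (k : ℤ)) - g n‖ ≤ M * k := by
    intro k n
    induction k with
    | zero => simp
    | succ k ih =>
      have h := hg j (n + Pi.single j (k : ℤ))
      rw [fwd, add_assoc, ← Pi.single_add] at h
      calc _ = ‖(g (n + Pi.single j ((k : ℤ) + 1)) - g (n + Pi.single j (k : ℤ))) +
            (g (n + Pi.single j (k : ℤ)) - g n)‖ := by push_cast; congr 1; abel
        _ ≤ M + M * k := (norm_add_le _ _).trans (add_le_add h ih)
        _ = _ := by push_cast; ring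
  obtain ⟨a, rfl | rfl⟩ := Int.eq_nat_or_neg k
  · simpa using hnat a n
  · have := hnat a (n + Pi.single j (-(a : ℤ)))
    rw [add_assoc, ← Pi.single_add, neg_add_cancel, Pi.single_zero, add_zero, norm_sub_rev] at this
    simpa using this

lemma norm_sub_le_of_fwd_le (hg : ∀ j n, ‖fwd j g n‖ ≤ M) (n m : Fin N → ℤ) :
    ‖g n - g m‖ ≤ M * len (n - m) := by
  have h : ∀ s : Finset (Fin N), ‖g (m + ∑ j ∈ s, Pi.single j ((n - m) j)) - g m‖ ≤
      M * ∑ j ∈ s, |(((n - m) j : ℤ) : ℝ)| := by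
    intro s
    induction s using Finset.induction_on with
    | empty => simp
    | insert j s hj ih =>
      rw [Finset.sum_insert hj, Finset.sum_insert hj, add_comm (Pi.single j _), ← add_assoc,
        mul_add]
      refine (norm_sub_le_norm_sub_add_norm_sub _
        (g (m + ∑ j ∈ s, Pi.single j ((n - m) j))) _).trans (add_le_add ?_ ih)
      exact norm_add_single_sub_le hg j _ _
  have h' := h Finset.univ
  rwa [Finset.univ_sum_single, add_sub_cancel] at h'

end Paths

/-! ### The increment integral. -/

section Increments

variable {N : ℕ} {α K : ℝ} {f : (Fin N → ℤ) → ℂ}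

/-- Split at t = L², where the two bounds are comparable. Convergence at 0 needs α > 0 and at
infinity α < 1; the two pieces give 4/α and 2/(1 - α). -/
lemma integral_Ioi_of_two_bounds {h : ℝ → ℂ} {A L : ℝ} (hα0 : 0 < α) (hα1 : α < 1)
    (hL : 0 < L) (hm : AEStronglyMeasurable h (volume.restrict (Ioi (0 : ℝ))))
    (h1 : ∀ t > 0, ‖h t‖ ≤ 2 * A * t ^ (α / 2 - 1))
    (h2 : ∀ t > 0, ‖h t‖ ≤ A * L * t ^ (α / 2 - 3 / 2)) :
    IntegrableOn h (Ioi 0) ∧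
      ‖∫ t in Ioi (0 : ℝ), h t‖ ≤ (4 / α + 2 / (1 - α)) * A * L ^ α := by
  have hL2 : 0 < L ^ 2 := by positivity
  have i1 : IntegrableOn (fun t : ℝ => 2 * A * t ^ (α / 2 - 1)) (Ioc 0 (L ^ 2)) := by
    have := intervalIntegral.intervalIntegrable_rpow' (a := 0) (b := L ^ 2)
      (show -1 < α / 2 - 1 by linarith)
    rw [intervalIntegrable_iff_integrableOn_Ioc_of_le hL2.le] at this
    exact this.const_mul _
  have i2 : IntegrableOn (fun t : ℝ => A * L * t ^ (α / 2 - 3 / 2)) (Ioi (L ^ 2)) :=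
    (integrableOn_Ioi_rpow_of_lt (by linarith) hL2).const_mul _
  have hsub1 : Ioc 0 (L ^ 2) ⊆ Ioi (0 : ℝ) := Ioc_subset_Ioi_self
  have hsub2 : Ioi (L ^ 2) ⊆ Ioi (0 : ℝ) := Ioi_subset_Ioi hL2.le
  have b1 : ∀ᵐ t ∂(volume.restrict (Ioc 0 (L ^ 2))), ‖h t‖ ≤ 2 * A * t ^ (α / 2 - 1) := by
    filter_upwards [ae_restrict_mem measurableSet_Ioc] with t ht using h1 t ht.1
  have b2 : ∀ᵐ t ∂(volume.restrict (Ioi (L ^ 2))), ‖h t‖ ≤ A * L * t ^ (α / 2 - 3 / 2) := by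
    filter_upwards [ae_restrict_mem measurableSet_Ioi] with t ht using h2 t (hsub2 ht)
  have j1 : IntegrableOn h (Ioc 0 (L ^ 2)) := i1.mono' (hm.mono_set hsub1) b1
  have j2 : IntegrableOn h (Ioi (L ^ 2)) := i2.mono' (hm.mono_set hsub2) b2
  refine ⟨by rw [← Ioc_union_Ioi_eq_Ioi hL2.le]; exact j1.union j2, ?_⟩
  rw [← Ioc_union_Ioi_eq_Ioi hL2.le,
    setIntegral_union (Ioc_disjoint_Ioi le_rfl) measurableSet_Ioi j1 j2]
  have e1 : ∫ t in Ioc 0 (L ^ 2), 2 * A * t ^ (α / 2 - 1) = 4 / α * A * L ^ α := by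
    rw [integral_const_mul, ← intervalIntegral.integral_of_le hL2.le,
      integral_rpow (Or.inl (by linarith)), sub_add_cancel, Real.zero_rpow (by positivity),
      ← Real.rpow_natCast, ← Real.rpow_mul hL.le]
    push_cast
    rw [mul_div_cancel₀ α (two_ne_zero)]
    field_simp
    ring
  have e2 : ∫ t in Ioi (L ^ 2), A * L * t ^ (α / 2 - 3 / 2) = 2 / (1 - α) * A * L ^ α := by
    have h1α : 1 - α ≠ 0 := by linarith
    have : L ^ α = L * L ^ (α - 1) := by rw [Real.rpow_sub_one hL.ne']; field_simp
    rw [integral_const_mul, integral_Ioi_rpow_of_lt (by linarith) hL2,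
      show α / 2 - 3 / 2 + 1 = (α - 1) / 2 by ring, ← Real.rpow_natCast, ← Real.rpow_mul hL.le]
    push_cast
    rw [mul_div_cancel₀ (α - 1) (two_ne_zero), this, ← neg_sub 1 α]
    field_simp
  calc _ ≤ _ := norm_add_le _ _
    _ ≤ _ := add_le_add (norm_integral_le_of_norm_le i1 b1) (norm_integral_le_of_norm_le i2 b2)
    _ = _ := by rw [e1, e2]; ring

/-- The constant of the Hölder estimate for the Riesz transforms. -/
noncomputable def rieszConst (N : ℕ) (α : ℝ) : ℝ := (4 / α + 2 / (1 - α)) * (1 + 2 * N)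

lemma rieszIncrement_bound (hf : HolderBound α K f) (hK : 0 ≤ K)
    (hα0 : 0 < α) (hα1 : α < 1) (i : Fin N) (n m : Fin N → ℤ) :
    IntegrableOn (rieszIncrementIntegrand i f n m) (Ioi 0) ∧
      ‖∫ t in Ioi (0 : ℝ), rieszIncrementIntegrand i f n m t‖ ≤
        rieszConst N α * K * len (n - m) ^ α := by
  by_cases hnm : n = m
  · subst hnm
    have h0 : rieszIncrementIntegrand i f n n = 0 := by
      funext t; simp [rieszIncrementIntegrand]
    rw [h0]
    refine ⟨integrableOn_zero, ?_⟩
    have : len (0 : Fin N → ℤ) = 0 := by simp [len]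
    simp [this, Real.zero_rpow hα0.ne']
  have hL : 0 < len (n - m) := len_pos (sub_ne_zero.2 hnm)
  have hm : AEStronglyMeasurable (rieszIncrementIntegrand i f n m)
      (volume.restrict (Ioi (0 : ℝ))) := by
    have hs := fun n => aestronglyMeasurable_heatSemigroup hf hK hα0 hα1 n
    refine (((hs _).sub (hs _)).sub ((hs _).sub (hs _))).mul
      (Measurable.aestronglyMeasurable (by fun_prop))
  have hnorm : ∀ t > 0, ‖rieszIncrementIntegrand i f n m t‖ =
      ‖fwd i (heatSemigroup t f) n - fwd i (heatSemigroup t f) m‖ * t ^ (-(1 / 2) : ℝ) :=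
    fun t ht => by
      rw [rieszIncrementIntegrand, norm_mul, Complex.norm_real,
        Real.norm_of_nonneg (Real.rpow_nonneg ht.le _)]
  -- The first bound is the triangle inequality for two first differences, hence the factor 2; the
  -- second sums mixed differences along a path of |n - m| steps.
  have key := integral_Ioi_of_two_bounds (A := K * (1 + 2 * N)) hα0 hα1 hL hm
    (fun t ht => by
      rw [hnorm t ht, show α / 2 - 1 = (α - 1) / 2 + -(1 / 2) by ring, Real.rpow_add ht,
        ← mul_assoc]
      gcongr
      have h := norm_fwd_heatSemigroup_le hf hK ht hα0 hα1 i
      linarith [norm_sub_le (fwd i (heatSemigroup t f) n) (fwd i (heatSemigroup t f) m), h n, h m])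
    (fun t ht => by
      rw [hnorm t ht, show α / 2 - 3 / 2 = (α / 2 - 1) + -(1 / 2) by ring, Real.rpow_add ht,
        ← mul_assoc]
      gcongr
      have h := norm_sub_le_of_fwd_le
        (fun j n => norm_fwd_fwd_heatSemigroup_le hf hK ht hα0 hα1 i j n) n m
      linarith)
  refine ⟨key.1, key.2.trans (le_of_eq ?_)⟩
  rw [rieszConst]; ring

lemma one_div_sqrt_pi_le_one : 1 / √Real.pi ≤ 1 := by
  rw [div_le_one (by positivity), Real.one_le_sqrt]
  linarith [Real.pi_gt_three]

lemma norm_rieszIncrement_le (hf : HolderBound α K f) (hK : 0 ≤ K)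
    (hα0 : 0 < α) (hα1 : α < 1) (i : Fin N) (n m : Fin N → ℤ) :
    ‖((1 / √Real.pi : ℝ) : ℂ) * ∫ t in Ioi (0 : ℝ), rieszIncrementIntegrand i f n m t‖ ≤
      rieszConst N α * K * len (n - m) ^ α := by
  rw [norm_mul, Complex.norm_real, Real.norm_of_nonneg (by positivity)]
  exact (mul_le_of_le_one_left (norm_nonneg _) one_div_sqrt_pi_le_one).trans
    (rieszIncrement_bound hf hK hα0 hα1 i n m).2

lemma rieszModConst_sub (hf : HolderBound α K f) (hK : 0 ≤ K)
    (hα0 : 0 < α) (hα1 : α < 1) (i : Fin N) (n m : Fin N → ℤ) :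
    rieszModConst i f n - rieszModConst i f m =
      ((1 / √Real.pi : ℝ) : ℂ) * ∫ t in Ioi (0 : ℝ), rieszIncrementIntegrand i f n m t := by
  rw [rieszModConst, rieszModConst, ← mul_sub, ← integral_sub
    (rieszIncrement_bound hf hK hα0 hα1 i n 0).1 (rieszIncrement_bound hf hK hα0 hα1 i m 0).1]
  congr 2
  funext t
  simp only [rieszIncrementIntegrand]; ring

lemma rieszTransform_sub (hc : FracIntegralConverges (1 / 2) f) (i : Fin N) (n m : Fin N → ℤ) :
    rieszTransform i f n - rieszTransform i f m =
      ((1 / √Real.pi : ℝ) : ℂ) * ∫ t in Ioi (0 : ℝ), rieszIncrementIntegrand i f n m t := by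
  simp only [rieszTransform, fwd, fracIntegral, Real.Gamma_one_half_eq]
  rw [← mul_sub, ← mul_sub, ← mul_sub, ← integral_sub (hc _) (hc _), ← integral_sub (hc _) (hc _),
    ← integral_sub (by exact (hc _).sub (hc _)) (by exact (hc _).sub (hc _))]
  congr 2
  funext t
  simp only [rieszIncrementIntegrand, fwd]
  norm_num
  ring

end Increments

/-! ### The seminorm and explicit Hölder constants. -/

section Seminorm

variable {N : ℕ} {α : ℝ} {f g : (Fin N → ℤ) → ℂ}

lemma MemHolder.holderBound (hf : MemHolder α f) :
    HolderBound α (holderSeminorm α f).toReal f := by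
  intro n m
  by_cases hnm : n = m
  · subst hnm
    rw [sub_self, norm_zero]
    exact mul_nonneg ENNReal.toReal_nonneg (Real.rpow_nonneg (len_nonneg _) _)
  have hpos : 0 < len (n - m) ^ α := Real.rpow_pos_of_pos (len_pos (sub_ne_zero.2 hnm)) _
  rw [← div_le_iff₀ hpos]
  refine (ENNReal.ofReal_le_iff_le_toReal hf.ne).1 ?_
  exact le_iSup_of_le n (le_iSup_of_le m (le_iSup_of_le hnm le_rfl))

lemma HolderBound.holderSeminorm_le {K : ℝ} (hg : HolderBound α K g) (hK : 0 ≤ K) :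
    holderSeminorm α g ≤ ENNReal.ofReal K := by
  refine iSup_le fun n => iSup_le fun m => iSup_le fun hnm => ENNReal.ofReal_le_ofReal ?_
  exact div_le_of_le_mul₀ (Real.rpow_nonneg (len_nonneg _) _) hK (hg n m)

end Seminorm

/-! ### Convergence of the integral for the Riesz kernel. -/

section Kernel

variable {N : ℕ} {t : ℝ}

/-- Distinct lattice points are at distance at least 1, so oscillation at most 1 suffices for every
exponent. -/
lemma holderBound_one_of_le {α : ℝ} (hα0 : 0 < α) {f : (Fin N → ℤ) → ℂ}
    (hf : ∀ n m, ‖f n - f m‖ ≤ 1) : HolderBound α 1 f := by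
  intro n m
  by_cases hnm : n = m
  · subst hnm
    rw [sub_self, norm_zero]
    exact mul_nonneg zero_le_one (Real.rpow_nonneg (len_nonneg _) _)
  · rw [one_mul]
    exact (hf n m).trans (Real.one_le_rpow (one_le_len (sub_ne_zero.2 hnm)) hα0.le)

/-- The unit mass at the origin. -/
noncomputable def unitMass (k : Fin N → ℤ) : ℂ := if k = 0 then 1 else 0

/-- The indicator function of the half line `{e_i, 2e_i, …}`. -/
noncomputable def halfLine (i : Fin N) (k : Fin N → ℤ) : ℂ :=
  if 1 ≤ k i ∧ ∀ l, l ≠ i → k l = 0 then 1 else 0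

lemma holderBound_unitMass {α : ℝ} (hα0 : 0 < α) : HolderBound (N := N) α 1 unitMass :=
  holderBound_one_of_le hα0 fun n m => by
    simp only [unitMass]; split_ifs <;> simp

lemma holderBound_halfLine {α : ℝ} (hα0 : 0 < α) (i : Fin N) : HolderBound α 1 (halfLine i) :=
  holderBound_one_of_le hα0 fun n m => by
    simp only [halfLine]; split_ifs <;> simp

/-- A bounded antiderivative of the unit mass: through it δ_i G_t becomes a second difference of a
semigroup and gains decay. -/
lemma fwd_halfLine (i : Fin N) : fwd i (halfLine i) = unitMass := by
  funext k
  have hoff : (∀ l, l ≠ i → (k + Pi.single i 1 : Fin N → ℤ) l = 0) ↔ ∀ l, l ≠ i → k l = 0 :=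
    forall₂_congr fun l hl => by simp [hl]
  have hzero : k = 0 ↔ k i = 0 ∧ ∀ l, l ≠ i → k l = 0 := by
    refine ⟨fun h => by simp [h], fun h => funext fun l => ?_⟩
    by_cases hl : l = i
    · rw [hl]; exact h.1
    · exact h.2 l hl
  have hi : (k + Pi.single i 1 : Fin N → ℤ) i = k i + 1 := by simp
  simp only [fwd, halfLine, unitMass, hoff, hzero, hi]
  rcases lt_trichotomy (k i) 0 with hk | hk | hk
  · simp [hk.ne, hk.not_ge, show ¬ 1 ≤ k i by omega]
  · simp [hk]
  · simp [hk.ne', hk.le, show 1 ≤ k i by omega]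

lemma heatSemigroup_unitMass (n : Fin N → ℤ) : heatSemigroup t unitMass n = heatKernel t n := by
  rw [heatSemigroup, tsum_eq_single 0 fun k hk => by simp [unitMass, hk]]
  simp [unitMass]

lemma fwd_heatKernel_eq (i : Fin N) (n : Fin N → ℤ) :
    ((fwd i (heatKernel t) n : ℝ) : ℂ) = fwd i (heatSemigroup t unitMass) n := by
  simp [fwd, heatSemigroup_unitMass]

lemma heatSemigroup_fwd {α K : ℝ} {f : (Fin N → ℤ) → ℂ} (hf : HolderBound α K f) (hK : 0 ≤ K)
    (ht : 0 < t) (hα0 : 0 < α) (hα1 : α < 1) (i : Fin N) :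
    heatSemigroup t (fwd i f) = fwd i (heatSemigroup t f) := by
  funext n
  have hI := fun n => integrable_holder hf hK ht hα0 hα1 n
  have hs : (fun ω => fwd i f (n - disp ω)) =
      fun ω => f (n + Pi.single i 1 - disp ω) - f (n - disp ω) := by
    funext ω; rw [fwd, sub_add_eq_add_sub]
  rw [fwd, heatSemigroup_eq_integral ht (hI _), heatSemigroup_eq_integral ht (hI _),
    heatSemigroup_eq_integral ht (by rw [hs]; exact (hI _).sub (hI _)), hs,
    integral_sub (hI _) (hI _)]

/-- With exponent 1/2, the unit mass gives t^{-3/4} near 0, which is not enough at infinity; there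
the half line gives t^{-5/4}. -/
lemma integrable_rieszKernel (i : Fin N) (n : Fin N → ℤ) :
    IntegrableOn (fun t => fwd i (heatKernel t) n * t ^ (-(1 / 2) : ℝ)) (Ioi 0) := by
  have hm : Measurable fun t : ℝ => fwd i (heatKernel t) n * t ^ (-(1 / 2) : ℝ) :=
    ((measurable_heatKernel _).sub (measurable_heatKernel _)).mul (by fun_prop)
  have hnorm : ∀ t > 0, ‖((fwd i (heatKernel t) n * t ^ (-(1 / 2) : ℝ) : ℝ) : ℂ)‖ =
      ‖fwd i (heatSemigroup t unitMass) n‖ * t ^ (-(1 / 2) : ℝ) := fun t ht => by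
    rw [Complex.ofReal_mul, norm_mul, fwd_heatKernel_eq, Complex.norm_real,
      Real.norm_of_nonneg (Real.rpow_nonneg ht.le _)]
  have h := integral_Ioi_of_two_bounds (α := 1 / 2) (A := 1 * (1 + 2 * N)) (L := 1)
    (h := fun t : ℝ => ((fwd i (heatKernel t) n * t ^ (-(1 / 2) : ℝ) : ℝ) : ℂ))
    (by norm_num) (by norm_num) one_pos hm.complex_ofReal.aestronglyMeasurable
    (fun t ht => by
      rw [hnorm t ht, show (1 / 2 : ℝ) / 2 - 1 = (1 / 2 - 1) / 2 + -(1 / 2) by ring,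
        Real.rpow_add ht, ← mul_assoc]
      gcongr
      refine (norm_fwd_heatSemigroup_le (holderBound_unitMass (by norm_num)) zero_le_one ht
        (α := 1 / 2) (by norm_num) (by norm_num) i n).trans ?_
      gcongr <;> norm_num)
    (fun t ht => by
      rw [hnorm t ht, show (1 / 2 : ℝ) / 2 - 3 / 2 = (1 / 2 / 2 - 1) + -(1 / 2) by ring,
        Real.rpow_add ht, ← mul_assoc, mul_one]
      gcongr
      rw [← fwd_halfLine i, heatSemigroup_fwd (holderBound_halfLine (α := 1 / 2) (by norm_num) i)
        zero_le_one ht (by norm_num) (by norm_num)]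
      exact norm_fwd_fwd_heatSemigroup_le (holderBound_halfLine (by norm_num) i) zero_le_one ht
        (by norm_num) (by norm_num) i i n)
  exact h.1.re

end Kernel

/-! ### Comparison of the convolution with the increment integral. -/

section Convolution

variable {N : ℕ} {t α K : ℝ} {f : (Fin N → ℤ) → ℂ} {B : (Fin N → ℕ × ℕ) → ℝ} {β : ℝ}

/-- By Tonelli, since for each ω only k = n - disp ω survives. Absolute sums against a weighted
kernel thus obey the same bounds as the expectations. -/
lemma tsum_enorm_integral_unitMass_le (r : ℝ≥0) (n : Fin N → ℤ) :
    ∑' k, ‖∫ ω, B ω • unitMass (n - k - disp ω) ∂(pairLaw N r)‖ₑ * ‖f k‖ₑ ≤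
      ∫⁻ ω, ‖B ω • f (n - disp ω)‖ₑ ∂(pairLaw N r) := by
  calc _ ≤ ∑' k, ∫⁻ ω, ‖B ω • unitMass (n - k - disp ω)‖ₑ * ‖f k‖ₑ ∂(pairLaw N r) := by
        refine ENNReal.tsum_le_tsum fun k => ?_
        rw [lintegral_mul_const _ .of_discrete]
        gcongr
        exact enorm_integral_le_lintegral_enorm _
    _ = ∫⁻ ω, ∑' k, ‖B ω • unitMass (n - k - disp ω)‖ₑ * ‖f k‖ₑ ∂(pairLaw N r) :=
        (lintegral_tsum fun k => Measurable.aemeasurable .of_discrete).symm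
    _ = _ := by
        refine lintegral_congr fun ω => ?_
        rw [tsum_eq_single (n - disp ω)]
        · simp [unitMass]
        · intro k hk
          have : n - k - disp ω ≠ 0 := fun h => hk <| by
            rw [sub_right_comm, sub_eq_zero] at h; exact h.symm
          simp [unitMass, this]

lemma tsum_enorm_le_ofReal (hf : HolderBound α K f) (hK : 0 ≤ K) (ht : 0 < t)
    (hα0 : 0 < α) (hα1 : α < 1) (n : Fin N → ℤ) (hβ : 0 < β)
    (hB : Integrable (fun ω => B ω ^ 2) (pairLaw N t.toNNReal))
    (hB2 : ∫ ω, B ω ^ 2 ∂(pairLaw N t.toNNReal) ≤ β ^ 2) :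
    ∑' k, ‖∫ ω, B ω • unitMass (n - k - disp ω) ∂(pairLaw N t.toNNReal)‖ₑ * ‖f k‖ₑ ≤
      ENNReal.ofReal ((‖f n‖ + K * t ^ (α / 2)) * ((1 + 2 * N) * β)) := by
  refine (tsum_enorm_integral_unitMass_le _ n).trans ?_
  rw [← ofReal_integral_norm_eq_lintegral_enorm (integrable_smul_holder hf hK ht hα0 hα1 n hB)]
  exact ENNReal.ofReal_le_ofReal (integral_norm_smul_le hf hK ht hα0 hα1 n hβ hB hB2)

lemma tsum_enorm_fwd_fwd_heatKernel_le (hf : HolderBound α K f) (hK : 0 ≤ K) (ht : 0 < t)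
    (hα0 : 0 < α) (hα1 : α < 1) (i j : Fin N) (n : Fin N → ℤ) :
    ∑' k, ‖((fwd j (fwd i (heatKernel t)) (n - k) : ℝ) : ℂ)‖ₑ * ‖f k‖ₑ ≤
      ENNReal.ofReal ((‖f (n + Pi.single j 1)‖ + K * t ^ (α / 2)) * ((1 + 2 * N) * t⁻¹)) := by
  refine le_trans (le_of_eq ?_) (tsum_enorm_le_ofReal hf hK ht hα0 hα1 (n + Pi.single j 1)
    (inv_pos.2 ht) (integrable_weight₂_sq i j) (integral_weight₂_sq ht i j).le)
  refine tsum_congr fun k => ?_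
  rw [fwd, Complex.ofReal_sub, fwd_heatKernel_eq, fwd_heatKernel_eq, ← fwd,
    fwd_fwd_heatSemigroup (holderBound_unitMass (α := 1 / 2) (by norm_num)) zero_le_one ht
      (by norm_num) (by norm_num), sub_add_eq_add_sub]

lemma tsum_enorm_heatKernel_le (hf : HolderBound α K f) (hK : 0 ≤ K) (ht : 0 < t)
    (hα0 : 0 < α) (hα1 : α < 1) (n : Fin N → ℤ) :
    ∑' k, ‖(heatKernel t (n - k) : ℂ)‖ₑ * ‖f k‖ₑ ≤
      ENNReal.ofReal ((‖f n‖ + K * t ^ (α / 2)) * (1 + 2 * N)) := by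
  refine le_trans (le_of_eq ?_) ((tsum_enorm_le_ofReal (B := fun _ => 1) hf hK ht hα0 hα1 n
    one_pos (integrable_const _) (by simp)).trans (by rw [mul_one]))
  refine tsum_congr fun k => ?_
  rw [← heatSemigroup_unitMass, heatSemigroup_eq_integral ht (integrable_holder
    (holderBound_unitMass (α := 1 / 2) (by norm_num)) zero_le_one ht (by norm_num) (by norm_num) _)]
  simp

/-- For small t the factor t⁻¹ of the weighted bound is too singular, so the four heat kernels of
the second difference are estimated separately. -/
lemma exists_tsum_enorm_fwd_fwd_heatKernel_le (hf : HolderBound α K f) (hK : 0 ≤ K)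
    (hα0 : 0 < α) (hα1 : α < 1) (i j : Fin N) (n : Fin N → ℤ) :
    ∃ C : ℝ, ∀ t, 0 < t → t ≤ 1 →
      ∑' k, ‖((fwd j (fwd i (heatKernel t)) (n - k) : ℝ) : ℂ)‖ₑ * ‖f k‖ₑ ≤ ENNReal.ofReal C := by
  set A : (Fin N → ℤ) → ℝ := fun m => (‖f m‖ + K) * (1 + 2 * N)
  have hA : ∀ m, 0 ≤ A m := fun m => by positivity
  have hb : ∀ t, 0 < t → t ≤ 1 → ∀ m,
      ∑' k, ‖(heatKernel t (m - k) : ℂ)‖ₑ * ‖f k‖ₑ ≤ ENNReal.ofReal (A m) := fun t ht ht1 m => by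
    refine (tsum_enorm_heatKernel_le hf hK ht hα0 hα1 m).trans (ENNReal.ofReal_le_ofReal ?_)
    have : t ^ (α / 2) ≤ 1 := Real.rpow_le_one ht.le ht1 (by positivity)
    have : K * t ^ (α / 2) ≤ K := mul_le_of_le_one_right hK this
    simp only [A]
    gcongr
  set a := n + Pi.single j 1 + Pi.single i 1
  set b := n + Pi.single j 1
  set c := n + Pi.single i 1
  refine ⟨A a + A b + (A c + A n), fun t ht ht1 => ?_⟩
  rw [ENNReal.ofReal_add (add_nonneg (hA _) (hA _)) (add_nonneg (hA _) (hA _)),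
    ENNReal.ofReal_add (hA _) (hA _), ENNReal.ofReal_add (hA _) (hA _)]
  refine le_trans ?_ (add_le_add (add_le_add (hb t ht ht1 a) (hb t ht ht1 b))
    (add_le_add (hb t ht ht1 c) (hb t ht ht1 n)))
  rw [← ENNReal.tsum_add, ← ENNReal.tsum_add, ← ENNReal.tsum_add]
  refine ENNReal.tsum_le_tsum fun k => ?_
  rw [← add_mul, ← add_mul, ← add_mul]
  gcongr
  simp only [fwd, Complex.ofReal_sub]
  rw [show n - k + Pi.single j 1 + Pi.single i 1 = a - k by simp only [a]; abel,
    show n - k + Pi.single j 1 = b - k by simp only [b]; abel,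
    show n - k + Pi.single i 1 = c - k by simp only [c]; abel]
  exact (enorm_sub_le).trans (add_le_add enorm_sub_le enorm_sub_le)

/-- The hypothesis for Fubini: the majorant is t^{-1/2} on (0, 1] and t^{α/2-3/2} beyond. The extra
difference δ_j supplies the integrability at infinity. -/
lemma tsum_lintegral_rieszIncrement_ne_top (hf : HolderBound α K f) (hK : 0 ≤ K)
    (hα0 : 0 < α) (hα1 : α < 1) (i j : Fin N) (n : Fin N → ℤ) :
    ∑' k, ∫⁻ t in Ioi (0 : ℝ), ‖((fwd j (fwd i (heatKernel t)) (n - k) : ℝ) : ℂ) * f k *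
      ((t ^ (-(1 / 2) : ℝ) : ℝ) : ℂ)‖ₑ ≠ ∞ := by
  have hmeas : ∀ k, Measurable fun t : ℝ =>
      ‖((fwd j (fwd i (heatKernel t)) (n - k) : ℝ) : ℂ) * f k *
        ((t ^ (-(1 / 2) : ℝ) : ℝ) : ℂ)‖ₑ := fun k => by
    have h := fun m : Fin N → ℤ => measurable_heatKernel m
    have h2 : Measurable fun t : ℝ => fwd j (fwd i (heatKernel t)) (n - k) :=
      ((h _).sub (h _)).sub ((h _).sub (h _))
    fun_prop
  have hsplit : ∀ t : ℝ, 0 < t → ∑' k, ‖((fwd j (fwd i (heatKernel t)) (n - k) : ℝ) : ℂ) * f k *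
      ((t ^ (-(1 / 2) : ℝ) : ℝ) : ℂ)‖ₑ =
      (∑' k, ‖((fwd j (fwd i (heatKernel t)) (n - k) : ℝ) : ℂ)‖ₑ * ‖f k‖ₑ) *
        ENNReal.ofReal (t ^ (-(1 / 2) : ℝ)) := fun t ht => by
    rw [← ENNReal.tsum_mul_right]
    refine tsum_congr fun k => ?_
    rw [enorm_mul, enorm_mul, ← ofReal_norm (((t ^ (-(1 / 2) : ℝ) : ℝ) : ℂ)), Complex.norm_real,
      Real.norm_of_nonneg (Real.rpow_nonneg ht.le _)]
  obtain ⟨C, hC⟩ := exists_tsum_enorm_fwd_fwd_heatKernel_le hf hK hα0 hα1 i j n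
  have i1 : IntegrableOn (fun t : ℝ => C * t ^ (-(1 / 2) : ℝ)) (Ioc 0 1) := by
    have := intervalIntegral.intervalIntegrable_rpow' (a := 0) (b := 1)
      (show (-1 : ℝ) < -(1 / 2) by norm_num)
    rw [intervalIntegrable_iff_integrableOn_Ioc_of_le zero_le_one] at this
    exact this.const_mul _
  set D : ℝ := (‖f (n + Pi.single j 1)‖ + K) * (1 + 2 * N)
  have i2 : IntegrableOn (fun t : ℝ => D * t ^ (α / 2 - 3 / 2)) (Ioi 1) :=
    (integrableOn_Ioi_rpow_of_lt (by linarith) one_pos).const_mul _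
  rw [← lintegral_tsum fun k => (hmeas k).aemeasurable, ← Ioc_union_Ioi_eq_Ioi zero_le_one,
    lintegral_union measurableSet_Ioi (Ioc_disjoint_Ioi le_rfl)]
  refine ENNReal.add_ne_top.2 ⟨(lt_of_le_of_lt (setLIntegral_mono' measurableSet_Ioc
    fun t ht => ?_) i1.lintegral_lt_top).ne, (lt_of_le_of_lt (setLIntegral_mono' measurableSet_Ioi
    fun t ht => ?_) i2.lintegral_lt_top).ne⟩
  · rw [hsplit t ht.1, ENNReal.ofReal_mul' (Real.rpow_nonneg ht.1.le _)]
    gcongr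
    exact hC t ht.1 ht.2
  · have ht1 : 1 < t := ht
    have ht0 : 0 < t := one_pos.trans ht1
    rw [hsplit t ht0, show α / 2 - 3 / 2 = (α / 2 - 1) + -(1 / 2) by ring, Real.rpow_add ht0,
      ← mul_assoc, ENNReal.ofReal_mul' (Real.rpow_nonneg ht0.le _)]
    gcongr
    refine (tsum_enorm_fwd_fwd_heatKernel_le hf hK ht0 hα0 hα1 i j n).trans
      (ENNReal.ofReal_le_ofReal ?_)
    have h1 : 1 ≤ t ^ (α / 2) := Real.one_le_rpow ht1.le (by positivity)
    have h2 : ‖f (n + Pi.single j 1)‖ ≤ ‖f (n + Pi.single j 1)‖ * t ^ (α / 2) :=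
      le_mul_of_one_le_right (norm_nonneg _) h1
    rw [Real.rpow_sub_one ht0.ne']
    calc _ ≤ (‖f (n + Pi.single j 1)‖ * t ^ (α / 2) + K * t ^ (α / 2)) *
          ((1 + 2 * N) * t⁻¹) := by gcongr
      _ = _ := by simp only [D]; ring

lemma hasSum_fwd_fwd_heatKernel_mul (hf : HolderBound α K f) (hK : 0 ≤ K) (ht : 0 < t)
    (hα0 : 0 < α) (hα1 : α < 1) (i j : Fin N) (n : Fin N → ℤ) :
    HasSum (fun k => ((fwd j (fwd i (heatKernel t)) (n - k) : ℝ) : ℂ) * f k)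
      (fwd j (fwd i (heatSemigroup t f)) n) := by
  have h : ∀ m, HasSum (fun k => (heatKernel t (m - k) : ℂ) * f k) (heatSemigroup t f m) :=
    fun m => by
      have hI := integrable_holder hf hK ht hα0 hα1 m
      rw [heatSemigroup_eq_integral ht hI]
      exact hasSum_heatKernel_mul ht hI
  simp only [fwd]
  refine (((h _).sub (h _)).sub ((h _).sub (h _))).congr_fun fun k => ?_
  simp only [Complex.ofReal_sub, sub_mul, sub_add_eq_add_sub]

lemma fwd_rieszConv (hf : HolderBound α K f) (hK : 0 ≤ K) (hα0 : 0 < α) (hα1 : α < 1)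
    (i : Fin N) (hs : ∀ n, Summable fun k => (rieszKernel i (n - k) : ℂ) * f k)
    (j : Fin N) (n : Fin N → ℤ) :
    fwd j (rieszConv i f) n = fwd j (rieszModConst i f) n := by
  have hker : ∀ k, (rieszKernel i (n + Pi.single j 1 - k) : ℂ) * f k -
      (rieszKernel i (n - k) : ℂ) * f k = ((1 / √Real.pi : ℝ) : ℂ) *
        ∫ t in Ioi (0 : ℝ), ((fwd j (fwd i (heatKernel t)) (n - k) : ℝ) : ℂ) * f k *
          ((t ^ (-(1 / 2) : ℝ) : ℝ) : ℂ) := fun k => by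
    rw [← sub_mul, ← Complex.ofReal_sub, rieszKernel, rieszKernel, ← mul_sub,
      ← integral_sub (integrable_rieszKernel i _) (integrable_rieszKernel i _),
      Complex.ofReal_mul, mul_assoc, ← integral_complex_ofReal, ← integral_mul_const]
    congr 2
    funext t
    rw [← sub_mul, ← sub_add_eq_add_sub, ← fwd]
    push_cast
    ring
  rw [fwd, rieszConv, rieszConv, ← (hs _).tsum_sub (hs _), tsum_congr hker, tsum_mul_left,
    ← integral_tsum (fun k => ?_) (tsum_lintegral_rieszIncrement_ne_top hf hK hα0 hα1 i j n),
    fwd, rieszModConst_sub hf hK hα0 hα1]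
  · congr 1
    refine setIntegral_congr_fun measurableSet_Ioi fun t ht => ?_
    rw [tsum_mul_right, (hasSum_fwd_fwd_heatKernel_mul hf hK ht hα0 hα1 i j n).tsum_eq]
    rfl
  · have h := fun m : Fin N → ℤ => measurable_heatKernel m
    have h2 : Measurable fun t : ℝ => fwd j (fwd i (heatKernel t)) (n - k) :=
      ((h _).sub (h _)).sub ((h _).sub (h _))
    exact Measurable.aestronglyMeasurable (by fun_prop)

/-- The difference of the two functions has zero forward differences, so the path estimate with M =
0 makes it constant. -/
lemma rieszConv_sub (hf : HolderBound α K f) (hK : 0 ≤ K) (hα0 : 0 < α) (hα1 : α < 1)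
    (i : Fin N) (hs : ∀ n, Summable fun k => (rieszKernel i (n - k) : ℂ) * f k)
    (n m : Fin N → ℤ) :
    rieszConv i f n - rieszConv i f m = rieszModConst i f n - rieszModConst i f m := by
  have h := norm_sub_le_of_fwd_le (g := fun k => rieszConv i f k - rieszModConst i f k) (M := 0)
    (fun j k => by
      have := fwd_rieszConv hf hK hα0 hα1 i hs j k
      simp only [fwd] at this ⊢
      rw [sub_sub_sub_comm, this, sub_self, norm_zero]) n m
  rw [zero_mul, norm_le_zero_iff, sub_sub_sub_comm, sub_eq_zero] at h
  exact h

end Convolution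

end DiscreteRiesz

theorem mainTheorem7 (N : ℕ) (hN : 2 ≤ N) (α : ℝ) (hα0 : 0 < α) (hα : α < 1 / 2) :
    ∃ C : ℝ≥0, ∀ (i : Fin N) (f : (Fin N → ℤ) → ℂ), DiscreteRiesz.MemHolder α f →
      -- `R_i f = δ_i^+ (-Δ_N)^{-1/2} f`, wherever `(-Δ_N)^{-1/2} f` is defined
      (DiscreteRiesz.FracIntegralConverges (1 / 2) f →
        DiscreteRiesz.holderSeminorm α (DiscreteRiesz.rieszTransform i f)
          ≤ C * DiscreteRiesz.holderSeminorm α f) ∧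
      -- `R_i f = 𝓡_i * f`, wherever the convolution is defined
      ((∀ n : Fin N → ℤ,
          Summable fun k : Fin N → ℤ => (DiscreteRiesz.rieszKernel i (n - k) : ℂ) * f k) →
        DiscreteRiesz.holderSeminorm α (DiscreteRiesz.rieszConv i f)
          ≤ C * DiscreteRiesz.holderSeminorm α f) ∧
      -- `R_i f` modulo additive constants, for every `f` in the Hölder class
      ((∀ n m : Fin N → ℤ,
          IntegrableOn (DiscreteRiesz.rieszIncrementIntegrand i f n m) (Ioi 0)) ∧
        DiscreteRiesz.holderSeminorm α (DiscreteRiesz.rieszModConst i f)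
          ≤ C * DiscreteRiesz.holderSeminorm α f) := by
  have hα1 : α < 1 := by linarith
  have hC : 0 ≤ DiscreteRiesz.rieszConst N α := by
    have : 0 < 1 - α := by linarith
    unfold DiscreteRiesz.rieszConst
    positivity
  refine ⟨(DiscreteRiesz.rieszConst N α).toNNReal, fun i f hf => ?_⟩
  have hb := hf.holderBound
  have hK : 0 ≤ (DiscreteRiesz.holderSeminorm α f).toReal := ENNReal.toReal_nonneg
  have hinc := DiscreteRiesz.norm_rieszIncrement_le hb hK hα0 hα1 i
  -- All three senses enter only through this formula for increments.
  have key : ∀ g : (Fin N → ℤ) → ℂ,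
      (∀ n m, g n - g m = ((1 / √Real.pi : ℝ) : ℂ) *
        ∫ t in Ioi (0 : ℝ), DiscreteRiesz.rieszIncrementIntegrand i f n m t) →
      DiscreteRiesz.holderSeminorm α g ≤
        (DiscreteRiesz.rieszConst N α).toNNReal * DiscreteRiesz.holderSeminorm α f :=
    fun g hg => by
      have h : DiscreteRiesz.HolderBound α
          (DiscreteRiesz.rieszConst N α * (DiscreteRiesz.holderSeminorm α f).toReal) g :=
        fun n m => by rw [hg]; exact hinc n m
      refine (h.holderSeminorm_le (by positivity)).trans (le_of_eq ?_)
      rw [ENNReal.ofReal_mul hC, ENNReal.ofReal_toReal hf.ne, ENNReal.ofReal]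
  have hmod := DiscreteRiesz.rieszModConst_sub hb hK hα0 hα1 i
  exact ⟨fun hc => key _ (DiscreteRiesz.rieszTransform_sub hc i),
    fun hs => key _ fun n m =>
      (DiscreteRiesz.rieszConv_sub hb hK hα0 hα1 i hs n m).trans (hmod n m),
    fun n m => (DiscreteRiesz.rieszIncrement_bound hb hK hα0 hα1 i n m).1, key _ hmod⟩
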